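/- Let $G^s=(V,E)$, $E\subseteq V\times V$, be a finite directed graph with a distinguished node $s\in V$ (loops are allowed), given by a list of the successors of each node in an arbitrary order, and let $k\ge 0$ be an integer. A path is a finite nonempty sequence of nodes in which consecutive nodes are joined by an edge; it is simple if its nodes are distinct. A simple cycle is a path $(v_1,\dots,v_m)$ with $m\ge 2$ and $v_1=v_m$ such that $(v_1,\dots,v_{m-1})$ is a simple path; its length is its number $m-1$ of edges. Consider the following procedures, which act on a global stack of nodes, locks $Lock(v)\in\mathbb{N}\cup\{\infty\}$, and sets $Blist(v)\subseteq V$. $RELAX\_LOCKS(u)$: if $Lock(u)<\infty$, then set $Lock(u):=\infty$ and, for each $w\in Blist(u)$ (in an arbitrary order), if $w$ is not on the stack, call $RELAX\_LOCKS(w)$. $CYCLE\_SEARCH(G^s,v,k,flen)$: 1. Set $blen:=\infty$ and $Lock(v):=flen$, and push $v$ onto the stack. 2. For each successor $w$ of $v$: if $w=s$, output the cycle consisting of the nodes on the stack (from bottom to top) followed by $w$, and set $blen:=1$; otherwise, if $flen+1<Lock(w)$ and $flen+1<k$, set $blen:=\min(blen,\,1+CYCLE\_SEARCH(G^s,w,k,flen+1))$.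 3. If $blen<\infty$, call $RELAX\_LOCKS(v)$; otherwise, add $v$ to $Blist(w)$ for every successor $w$ of $v$. 4. Pop $v$ from the stack and return $blen$. Started with all locks equal to $\infty$, all Blists empty and an empty stack, the call $CYCLE\_SEARCH(G^s,s,k,0)$ terminates and outputs every simple cycle of $G^s$ of length at most $k$ that starts at $s$. -/

import Mathlib

/-- The data on which the bounded-length cycle search operates: the locks (a natural number
or `⊤` for infinity), the Blists, the search stack (bottom first, top last), and the list of
cycles output so far. -/
@[ext]
structure SearchState (V : Type*) where
  lock : V → ℕ∞
  blist : V → Finset V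
  stack : List V
  output : List (List V)

/-- The state before the search: all locks are infinite, all Blists and the stack are empty,
nothing has been output. -/
def SearchState.init (V : Type*) : SearchState V where
  lock := fun _ => ⊤
  blist := fun _ => ∅
  stack := []
  output := []

/-- A path in `G`: a finite nonempty sequence of nodes, consecutive ones joined by an edge. -/
def IsPath {V : Type*} (G : Digraph V) (p : List V) : Prop :=
  p ≠ [] ∧ p.IsChain G.Adj

/-- A simple path: all nodes are distinct. -/
def IsSimplePath {V : Type*} (G : Digraph V) (p : List V) : Prop :=
  IsPath G p ∧ p.Nodup

/-- A simple cycle `(v₁, …, vₘ)`: a path with `m ≥ 2` and `v₁ = vₘ` such that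
`(v₁, …, vₘ₋₁)` is a simple path. -/
def IsSimpleCycle {V : Type*} (G : Digraph V) (c : List V) : Prop :=
  2 ≤ c.length ∧ IsPath G c ∧ IsSimplePath G c.dropLast ∧ c.head? = c.getLast?

/-- The length of a path or cycle: its number of edges (the sequence is nonempty). -/
def pathLength {V : Type*} (p : List V) : ℕ := p.length - 1

/-- The modified `RELAX_LOCKS`: a finite lock of `u` is reset to infinity, and the procedure
recurses to the members of `Blist(u)` that are not on the stack. The members of `Blist(u)` are
visited in the order `order σ u`, where `σ` is the state in which the procedure is called.
(The bound `k` and the length `blen` no longer influence the procedure and are not passed.)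
The first argument bounds the depth of the recursion that is carried out; the result is `none`
if that bound is exceeded, and the result of the procedure otherwise. -/
def relaxLocks {V : Type*} [DecidableEq V] (order : SearchState V → V → List V) :
    ℕ → V → SearchState V → Option (SearchState V)
  | 0, _, _ => none
  | n + 1, u, σ =>
    if σ.lock u < ⊤ then
      (order σ u).foldlM
        (fun τ w => if w ∉ τ.stack then relaxLocks order n w τ else some τ)
        { σ with lock := Function.update σ.lock u ⊤ }
    else some σ

/-- Put `v` on the Blist of `w`. -/
def addToBlist {V : Type*} [DecidableEq V] (v : V) (σ : SearchState V) (w : V) :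
    SearchState V :=
  { σ with blist := Function.update σ.blist w (insert v (σ.blist w)) }

/-- `CYCLE_SEARCH` at node `v` with start node `s`, length bound `k`, and current depth `flen`.
`succ v` lists the successors of `v`. The result is the returned value `blen` together with the
final state. The first explicit natural number bounds the depth of the recursion that is carried
out; the result is `none` if that bound is exceeded (here or in `relaxLocks`), and the result of
the search otherwise. -/
noncomputable def cycleSearch {V : Type*} [DecidableEq V] (succ : V → List V)
    (order : SearchState V → V → List V) (s : V) (k : ℕ) :
    (n : ℕ) → (v : V) → (flen : ℕ) → SearchState V → Option (ℕ∞ × SearchState V)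
  | 0, _, _, _ => none
  | n + 1, v, flen, σ => do
    -- set the lock of `v`, push `v`, start with `blen = ∞`, and go through the successors
    let r ← (succ v).foldlM
      (fun (x : ℕ∞ × SearchState V) w =>
        if w = s then
          -- a cycle has been found: output it and set `blen` to 1
          some ((1 : ℕ∞), { x.2 with output := x.2.output ++ [x.2.stack ++ [w]] })
        else if ((flen + 1 : ℕ) : ℕ∞) < x.2.lock w ∧ flen + 1 < k then do
          let y ← cycleSearch succ order s k n w (flen + 1) x.2
          some (min x.1 (1 + y.1), y.2)
        else some x)
      ((⊤ : ℕ∞), { σ with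
        lock := Function.update σ.lock v (flen : ℕ∞)
        stack := σ.stack ++ [v] })
    -- relax the locks if a cycle has been found, otherwise put `v` on its successors' Blists
    let τ ← if r.1 < ⊤ then relaxLocks order n v r.2
      else some ((succ v).foldl (addToBlist v) r.2)
    -- pop `v` and return `blen`
    some (r.1, { τ with stack := τ.stack.dropLast })

/-!
The locks and Blists are kept consistent: a node `u` off the stack with finite lock `f` is a dead
end at depth `f`, that is, `s` is not a successor of `u`, and each successor of `u` is locked at
`f + 1` or lower unless the bound `k` rules out depth `f + 1` anyway. Unlocking a successor of `u`
would break this, but `u` is on the Blist of that successor, so `RELAX_LOCKS` unlocks `u` along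
with it. Now let `x₁, …, xⱼ` be nodes off the stack that lead to `s` and complete a short cycle.
If `x₁` were locked at or below the depth at which it would be reached, then so would be `x₂`, and
so on up to `xⱼ`; but `xⱼ` has `s` as a successor, so it is not a dead end. Hence the lock test
prunes no prefix of a short cycle.

The recursion depth of `CYCLE_SEARCH` is bounded through `k`, and each nested call of `RELAX_LOCKS`
has fewer locked nodes than its caller, only finitely many nodes being locked at any time.
-/

open Filter

section Fold

universe u

variable {m : Type u → Type*} [Monad m] [LawfulMonad m] {α ι : Type*} {β : Type u}

theorem exists_eventually_foldlM_eq_pure {F : Filter ι} {f : ι → β → α → m β}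
    {P : List α → β → Prop} {x : β} (L : List α) (h_nil : P [] x)
    (h_concat : ∀ l a y, P l y → ∃ z, P (l ++ [a]) z ∧ ∀ᶠ i in F, f i y a = pure z) :
    ∃ y, P L y ∧ ∀ᶠ i in F, L.foldlM (f i) x = pure y := by
  induction L using List.reverseRecOn with
  | nil => exact ⟨x, h_nil, .of_forall fun _ => rfl⟩
  | append_singleton L a ih =>
    obtain ⟨y, hy, hLy⟩ := ih
    obtain ⟨z, hz, hyz⟩ := h_concat L a y hy
    refine ⟨z, hz, ?_⟩
    filter_upwards [hLy, hyz] with i hi hi'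
    simp [List.foldlM_append, hi, hi']

end Fold

section ShortCycle

variable {V : Type*} {succ : V → List V} {s : V} {k : ℕ} {p S : List V}

/-- The simple cycle `p ++ [s]` starts at `s` and has length at most `k`. The final return to `s`
is left out of `p`, so that the search stack can be compared with prefixes of `p`. -/
structure IsShortCycle (succ : V → List V) (s : V) (k : ℕ) (p : List V) : Prop where
  isChain : (p ++ [s]).IsChain fun x y => y ∈ succ x
  nodup : p.Nodup
  head?_eq : p.head? = some s
  length_le : p.length ≤ k

theorem IsSimpleCycle.exists_isShortCycle {G : Digraph V} {c : List V}
    (hG : ∀ v w, G.Adj v w → w ∈ succ v) (hc : IsSimpleCycle G c) (hs : c.head? = some s)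
    (hk : pathLength c ≤ k) : ∃ p, IsShortCycle succ s k p ∧ p ++ [s] = c := by
  obtain ⟨hlen, ⟨-, hchain⟩, ⟨-, hnodup⟩, hlast⟩ := hc
  obtain ⟨p, rfl⟩ := List.getLast?_eq_some_iff.1 (hlast.symm.trans hs)
  rw [List.dropLast_concat] at hnodup
  refine ⟨p, ⟨hchain.imp hG, hnodup, ?_, by simpa [pathLength] using hk⟩, rfl⟩
  have hp : p ≠ [] := by rintro rfl; simp at hlen
  rwa [List.head?_append_of_ne_nil _ hp] at hs

theorem IsShortCycle.exists_mem_succ_isPrefix (hp : IsShortCycle succ s k p) {v : V}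
    (hv : S ++ [v] <+: p) : ∃ w ∈ succ v, S ++ [v] ++ [w] <+: p ++ [s] := by
  obtain ⟨q, rfl⟩ := hv
  obtain ⟨w, r, hr⟩ := List.exists_cons_of_ne_nil (List.concat_ne_nil s q)
  have hchain := hp.isChain
  rw [List.append_assoc, hr] at hchain
  refine ⟨w, (List.isChain_append.1 hchain).2.2 v (by simp) w (by simp), r, ?_⟩
  simp [hr]

theorem IsShortCycle.eq_of_isPrefix (hp : IsShortCycle succ s k p) (hS : S ≠ [])
    (hSp : S ++ [s] <+: p ++ [s]) : p = S := by
  rcases List.prefix_concat_iff.1 hSp with h | ⟨q, rfl⟩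
  · exact (List.append_cancel_right h).symm
  · have hs : s ∈ S := by
      have hhead := hp.head?_eq
      rw [List.append_assoc, List.head?_append_of_ne_nil _ hS] at hhead
      exact List.mem_of_mem_head? hhead
    have hnodup := hp.nodup
    exact absurd rfl ((List.nodup_append.1 (List.nodup_append.1 hnodup).1).2.2 s hs s (by simp))

theorem isPrefix_of_isPrefix_concat_of_ne {w : V} (hw : w ≠ s) (h : S ++ [w] <+: p ++ [s]) :
    S ++ [w] <+: p :=
  (List.prefix_concat_iff.1 h).resolve_left fun heq => hw (by simpa using heq : S = p ∧ w = s).2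

end ShortCycle

namespace SearchState

section Locks

variable {V : Type*} {succ : V → List V} {s v w : V} {k f : ℕ} {p l : List V}
  {σ τ ρ : SearchState V}

/-- A search at depth `f` through the successors listed in `l` would neither find a cycle nor
descend any further. -/
def DeadEnd (s : V) (k f : ℕ) (l : List V) (σ : SearchState V) : Prop :=
  ∀ w ∈ l, w ≠ s ∧ (f + 1 < k → σ.lock w ≤ (f + 1 : ℕ))

theorem DeadEnd.concat (h : σ.DeadEnd s k f l) (hle : τ.lock ≤ σ.lock) (hws : w ≠ s)
    (hw : f + 1 < k → τ.lock w ≤ (f + 1 : ℕ)) : τ.DeadEnd s k f (l ++ [w]) :=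
  List.forall_mem_append.2 ⟨fun x hx => ⟨(h x hx).1, fun hk => (hle x).trans ((h x hx).2 hk)⟩,
    List.forall_mem_singleton.2 ⟨hws, hw⟩⟩

/-- The invariant satisfied by the locks and the Blists: a locked node off the stack is a dead end,
and stands on the Blists of its successors so that it is unlocked as soon as one of them is. -/
def LocksConsistent (succ : V → List V) (s : V) (k : ℕ) (σ : SearchState V) : Prop :=
  ∀ u ∉ σ.stack, ∀ f : ℕ, σ.lock u = f →
    σ.DeadEnd s k f (succ u) ∧ ∀ w ∈ succ u, u ∈ σ.blist w

theorem LocksConsistent.lt_lock_of_isChain (h : σ.LocksConsistent succ s k) {q : List V} {m : ℕ}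
    (hchain : (w :: q ++ [s]).IsChain fun x y => y ∈ succ x) (hq : ∀ x ∈ w :: q, x ∉ σ.stack)
    (hm : m + q.length < k) : (m : ℕ∞) < σ.lock w := by
  induction q generalizing w m with
  | nil =>
    by_contra! hle
    obtain ⟨f, hf⟩ := ENat.ne_top_iff_exists.1 (ne_top_of_le_ne_top (ENat.natCast_ne_top m) hle)
    have hs : s ∈ succ w := by simpa using hchain
    exact ((h w (hq w (by simp)) f hf.symm).1 s hs).1 rfl
  | cons y q ih =>
    by_contra! hle
    obtain ⟨f, hf⟩ := ENat.ne_top_iff_exists.1 (ne_top_of_le_ne_top (ENat.natCast_ne_top m) hle)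
    have hfm : f ≤ m := by rwa [← hf, Nat.cast_le] at hle
    rw [List.length_cons] at hm
    have hy : y ∈ succ w := (List.isChain_cons_cons.1 hchain).1
    have hlt : ((m + 1 : ℕ) : ℕ∞) < σ.lock y :=
      ih hchain.tail (fun x hx => hq x (List.mem_cons_of_mem _ hx)) (by lia)
    have hy_le := ((h w (hq w (by simp)) f hf.symm).1 y hy).2 (by lia)
    exact absurd (Nat.cast_lt.1 (hlt.trans_le hy_le)) (by lia)

theorem LocksConsistent.lt_lock_of_isPrefix (h : σ.LocksConsistent succ s k)
    (hp : IsShortCycle succ s k p) (hw : σ.stack ++ [w] <+: p) :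
    σ.stack.length < k ∧ (σ.stack.length : ℕ∞) < σ.lock w := by
  obtain ⟨q, rfl⟩ := hw
  have hchain := hp.isChain
  have hnodup := hp.nodup
  have hlen := hp.length_le
  rw [List.append_assoc] at hnodup
  simp only [List.append_assoc] at hchain
  simp only [List.length_append, List.length_singleton] at hlen
  exact ⟨by lia, h.lt_lock_of_isChain (List.isChain_append.1 hchain).2.1
    (fun x hx hxs => List.disjoint_of_nodup_append hnodup hxs hx) (by lia)⟩

/-- The search has led from `σ` back to the same stack without touching the locks of the nodes on
it, and without losing any output. -/
structure IsProgress (σ τ : SearchState V) : Prop where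
  stack_eq : τ.stack = σ.stack
  output_subset : σ.output ⊆ τ.output
  lock_eq : ∀ x ∈ σ.stack, τ.lock x = σ.lock x

theorem IsProgress.refl (σ : SearchState V) : IsProgress σ σ :=
  ⟨rfl, List.Subset.refl _, fun _ _ => rfl⟩

theorem IsProgress.trans (h₁ : IsProgress σ τ) (h₂ : IsProgress τ ρ) : IsProgress σ ρ where
  stack_eq := h₂.stack_eq.trans h₁.stack_eq
  output_subset := List.Subset.trans h₁.output_subset h₂.output_subset
  lock_eq x hx := (h₂.lock_eq x (h₁.stack_eq ▸ hx)).trans (h₁.lock_eq x hx)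

/-- The invariant of the whole search. Since the locks on the stack are at most its height, the lock
test of `CYCLE_SEARCH` never lets the search enter a node on the stack. -/
structure IsValid (succ : V → List V) (s : V) (k : ℕ) (σ : SearchState V) : Prop where
  lock_le : ∀ x ∈ σ.stack, σ.lock x ≤ σ.stack.length
  finite_locked : {x | σ.lock x ≠ ⊤}.Finite
  locksConsistent : σ.LocksConsistent succ s k

theorem isValid_init (succ : V → List V) (s : V) (k : ℕ) : (init V).IsValid succ s k where
  lock_le := by simp [init]
  finite_locked := by simp [init]
  locksConsistent u _ f hf := by simp [init] at hf

theorem IsValid.notMem_stack (h : σ.IsValid succ s k) (hv : (σ.stack.length : ℕ∞) < σ.lock v) :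
    v ∉ σ.stack :=
  fun hmem => (h.lock_le v hmem).not_gt hv

/-- The last action of `CYCLE_SEARCH`: the top of the stack is removed. -/
def pop (σ : SearchState V) : SearchState V :=
  { σ with stack := σ.stack.dropLast }

/-- What a call of `RELAX_LOCKS` at a node off the stack may do: some locks of nodes off the stack
are reset to infinity, and those whose lock has been reset have all of their Blist on the stack
or unlocked. -/
structure IsRelaxation (σ τ : SearchState V) : Prop where
  stack_eq : τ.stack = σ.stack
  blist_eq : τ.blist = σ.blist
  output_eq : τ.output = σ.output
  lock_eq_or : ∀ x, τ.lock x = σ.lock x ∨ x ∉ σ.stack ∧ τ.lock x = ⊤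
  blist_unlocked : ∀ w, τ.lock w ≠ σ.lock w → ∀ x ∈ σ.blist w, x ∈ σ.stack ∨ τ.lock x = ⊤

namespace IsRelaxation

theorem refl (σ : SearchState V) : IsRelaxation σ σ :=
  ⟨rfl, rfl, rfl, fun _ => .inl rfl, fun _ h => absurd rfl h⟩

theorem lock_eq_top (h : IsRelaxation σ τ) {x : V} (hx : σ.lock x = ⊤) : τ.lock x = ⊤ :=
  (h.lock_eq_or x).elim (fun heq => heq.trans hx) And.right

theorem trans (h₁ : IsRelaxation σ τ) (h₂ : IsRelaxation τ ρ) : IsRelaxation σ ρ where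
  stack_eq := h₂.stack_eq.trans h₁.stack_eq
  blist_eq := h₂.blist_eq.trans h₁.blist_eq
  output_eq := h₂.output_eq.trans h₁.output_eq
  lock_eq_or x := by
    rcases h₂.lock_eq_or x with hx | hx
    · rw [hx]
      exact h₁.lock_eq_or x
    · exact .inr (h₁.stack_eq ▸ hx)
  blist_unlocked w hw x hx := by
    by_cases hτ : τ.lock w = σ.lock w
    · rw [← h₁.stack_eq]
      exact h₂.blist_unlocked w (hτ ▸ hw) x (h₁.blist_eq ▸ hx)
    · exact (h₁.blist_unlocked w hτ x hx).imp_right h₂.lock_eq_top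

end IsRelaxation

end Locks

section Relax

variable {V : Type*} [DecidableEq V] {succ : V → List V} {s u v w : V} {k : ℕ} {S : List V}
  {σ τ : SearchState V}

/-- The first action of `RELAX_LOCKS(u)`. -/
def unlock (u : V) (σ : SearchState V) : SearchState V :=
  { σ with lock := Function.update σ.lock u ⊤ }

theorem unlock_eq_self (hu : σ.lock u = ⊤) : σ.unlock u = σ := by
  simp [unlock, ← hu]

namespace IsRelaxation

theorem lock_self (h : IsRelaxation (σ.unlock u) τ) : τ.lock u = ⊤ :=
  h.lock_eq_top (Function.update_self ..)

theorem lock_eq_or_of_unlock (h : IsRelaxation (σ.unlock u) τ) (x : V) :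
    τ.lock x = σ.lock x ∨ (x = u ∨ x ∉ σ.stack) ∧ τ.lock x = ⊤ := by
  by_cases hx : x = u
  · exact .inr ⟨.inl hx, hx ▸ h.lock_self⟩
  · exact (h.lock_eq_or x).imp (fun heq => heq.trans (Function.update_of_ne hx ..))
      (And.imp_left .inr)

theorem locked_ssubset (h : IsRelaxation (σ.unlock u) τ) (hu : σ.lock u ≠ ⊤) :
    {x | τ.lock x ≠ ⊤} ⊂ {x | σ.lock x ≠ ⊤} := by
  refine (Set.ssubset_iff_of_subset fun x (hx : τ.lock x ≠ ⊤) => ?_).2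
    ⟨u, hu, not_not.2 h.lock_self⟩
  exact ((h.lock_eq_or_of_unlock x).resolve_right fun htop => hx htop.2).symm.trans_ne hx

end IsRelaxation

/-- The postcondition of `RELAX_LOCKS(u)`, which is also called at the top `u` of the stack: called
in the state `σ`, it leaves the state `τ`. -/
structure RelaxResult (u : V) (σ τ : SearchState V) : Prop extends
    IsRelaxation (σ.unlock u) τ where
  blist_unlocked_self : σ.lock u ≠ ⊤ → ∀ x ∈ σ.blist u, x ∈ σ.stack ∨ τ.lock x = ⊤

namespace RelaxResult

theorem blist_unlocked_of_lock_ne (h : RelaxResult u σ τ) (hw : τ.lock w ≠ σ.lock w) :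
    ∀ x ∈ σ.blist w, x ∈ σ.stack ∨ τ.lock x = ⊤ := by
  by_cases hwu : w = u
  · subst hwu
    exact h.blist_unlocked_self fun htop => hw (h.lock_self.trans htop.symm)
  · exact h.blist_unlocked w (by simpa [unlock, Function.update_of_ne hwu] using hw)

theorem isRelaxation (h : RelaxResult u σ τ) (hu : u ∉ σ.stack) : IsRelaxation σ τ where
  stack_eq := h.stack_eq
  blist_eq := h.blist_eq
  output_eq := h.output_eq
  lock_eq_or x := (h.lock_eq_or_of_unlock x).imp_right <| And.imp_left fun hx =>
    hx.elim (fun hxu => hxu ▸ hu) id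
  blist_unlocked _ := h.blist_unlocked_of_lock_ne

end RelaxResult

theorem exists_relaxLocks_eq {order : SearchState V → V → List V}
    (horder : ∀ σ u, ∀ w ∈ σ.blist u, w ∈ order σ u) (u : V) (σ : SearchState V)
    (hfin : {x | σ.lock x ≠ ⊤}.Finite) :
    ∃ τ, RelaxResult u σ τ ∧ ∀ᶠ n in atTop, relaxLocks order n u σ = some τ := by
  induction hc : {x | σ.lock x ≠ ⊤}.ncard using Nat.strong_induction_on generalizing u σ with
  | h c ih =>
  subst hc
  rw [← map_add_atTop_eq_nat 1]
  simp only [eventually_map, relaxLocks, lt_top_iff_ne_top]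
  by_cases hu : σ.lock u = ⊤
  · exact ⟨σ, ⟨by rw [unlock_eq_self hu]; exact .refl σ, absurd hu⟩, by simp [hu]⟩
  simp only [ne_eq, hu, not_false_eq_true, if_true]
  obtain ⟨τ, ⟨hτ, hvisited⟩, hrun⟩ := exists_eventually_foldlM_eq_pure (order σ u)
    (P := fun l τ => IsRelaxation (σ.unlock u) τ ∧ ∀ x ∈ l, x ∈ σ.stack ∨ τ.lock x = ⊤)
    (f := fun n (τ : SearchState V) w => if w ∉ τ.stack then relaxLocks order n w τ else some τ)
    (x := σ.unlock u) (F := atTop) ⟨.refl _, by simp⟩ <| by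
      rintro l w τ ⟨hτ, hl⟩
      by_cases hw : w ∈ τ.stack
      · have hwσ : w ∈ σ.stack := hτ.stack_eq ▸ hw
        exact ⟨τ, ⟨hτ, List.forall_mem_append.2 ⟨hl, by simp [hwσ]⟩⟩, by simp [hw]⟩
      · have hlocked := hτ.locked_ssubset hu
        obtain ⟨ρ, hρ, hrun⟩ := ih _ (Set.ncard_lt_ncard hlocked hfin) w τ
          (hfin.subset hlocked.subset) rfl
        have hτρ := hρ.isRelaxation hw
        exact ⟨ρ, ⟨hτ.trans hτρ, List.forall_mem_append.2
          ⟨fun x hx => (hl x hx).imp_right hτρ.lock_eq_top, by simp [hρ.lock_self]⟩⟩,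
          by simpa [hw] using hrun⟩
  exact ⟨τ, ⟨hτ, fun _ x hx => hvisited x (horder σ u x hx)⟩, hrun⟩

theorem LocksConsistent.pop_of_relaxResult (h : σ.LocksConsistent succ s k)
    (hστ : RelaxResult v σ τ) (hstack : σ.stack = S ++ [v]) : τ.pop.LocksConsistent succ s k := by
  intro u hu f (hf : τ.lock u = f)
  have hτu : τ.lock u ≠ ⊤ := hf ▸ ENat.natCast_ne_top f
  have huS : u ∉ S := by simpa [pop, hστ.stack_eq, unlock, hstack] using hu
  have huσ : u ∉ σ.stack := by
    have huv : u ≠ v := by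
      rintro rfl
      exact hτu hστ.lock_self
    simp [hstack, huS, huv]
  have hσu : σ.lock u = f := by
    rw [← hf]
    exact ((hστ.lock_eq_or_of_unlock u).resolve_right fun h => hτu h.2).symm
  obtain ⟨hdead, hblist⟩ := h u huσ f hσu
  refine ⟨fun w hw => ?_, fun w hw => ?_⟩
  · have hlock : τ.lock w = σ.lock w := by
      by_contra hne
      exact (hστ.blist_unlocked_of_lock_ne hne u (hblist w hw)).elim huσ hτu
    exact ⟨(hdead w hw).1, fun hk => hlock.trans_le ((hdead w hw).2 hk)⟩
  · exact hστ.blist_eq ▸ hblist w hw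

theorem foldl_addToBlist (v : V) (l : List V) (σ : SearchState V) :
    l.foldl (addToBlist v) σ =
      { σ with blist := fun w => if w ∈ l then insert v (σ.blist w) else σ.blist w } := by
  induction l generalizing σ with
  | nil => simp
  | cons a l ih =>
    rw [List.foldl_cons, ih]
    ext w x <;> simp only [addToBlist]
    by_cases hwa : w = a
    · subst hwa
      simp
    · simp [hwa]

theorem LocksConsistent.pop_foldl_addToBlist {f : ℕ} (h : σ.LocksConsistent succ s k)
    (hstack : σ.stack = S ++ [v]) (hf : σ.lock v = f) (hdead : σ.DeadEnd s k f (succ v)) :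
    ((succ v).foldl (addToBlist v) σ).pop.LocksConsistent succ s k := by
  rw [foldl_addToBlist]
  intro u hu g (hg : σ.lock u = g)
  by_cases huv : u = v
  · subst huv
    obtain rfl : f = g := Nat.cast_injective (hf.symm.trans hg)
    exact ⟨hdead, fun w hw => by simp [pop, hw]⟩
  · have huS : u ∉ S := by simpa [pop, hstack] using hu
    obtain ⟨hdead, hblist⟩ := h u (by simp [hstack, huS, huv]) g hg
    refine ⟨hdead, fun w hw => ?_⟩
    have hu_blist := hblist w hw
    dsimp only [pop]
    split_ifs <;> simp [hu_blist]

end Relax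

section Search

variable {V : Type*} [DecidableEq V] {succ : V → List V} {s v w : V} {k : ℕ} {l : List V}
  {b b' : ℕ∞} {σ τ ρ : SearchState V}

/-- The first action of `CYCLE_SEARCH` at `v`; the current depth is the height of the stack. -/
def push (v : V) (σ : SearchState V) : SearchState V :=
  { σ with lock := Function.update σ.lock v (σ.stack.length : ℕ∞), stack := σ.stack ++ [v] }

theorem lock_push_le (hv : (σ.stack.length : ℕ∞) < σ.lock v) : (σ.push v).lock ≤ σ.lock :=
  update_le_self_iff.2 hv.le

theorem LocksConsistent.push (h : σ.LocksConsistent succ s k)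
    (hv : (σ.stack.length : ℕ∞) < σ.lock v) : (σ.push v).LocksConsistent succ s k := by
  intro u hu f hf
  obtain ⟨hus, huv⟩ : u ∉ σ.stack ∧ u ≠ v := by simpa [SearchState.push] using hu
  obtain ⟨hdead, hblist⟩ := h u hus f ((Function.update_of_ne huv ..).symm.trans hf)
  exact ⟨fun w hw => ⟨(hdead w hw).1, fun hk => (lock_push_le hv w).trans ((hdead w hw).2 hk)⟩,
    hblist⟩

theorem IsValid.push (h : σ.IsValid succ s k) (hv : (σ.stack.length : ℕ∞) < σ.lock v) :
    (σ.push v).IsValid succ s k where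
  lock_le x hx := by
    have hlen : (σ.stack.length : ℕ∞) ≤ (σ.push v).stack.length := by
      simp [SearchState.push]
    by_cases hxv : x = v
    · subst hxv
      simp [SearchState.push]
    · have hxσ : x ∈ σ.stack := by simpa [SearchState.push, hxv] using hx
      exact (lock_push_le hv x).trans ((h.lock_le x hxσ).trans hlen)
  finite_locked := by
    refine (h.finite_locked.insert v).subset fun x hx => ?_
    by_cases hxv : x = v
    · exact .inl hxv
    · exact .inr (by simpa [SearchState.push, hxv] using hx)
  locksConsistent := h.locksConsistent.push hv

/-- The postcondition of `CYCLE_SEARCH` at `v`: called in the state `σ`, it returns `b` and leaves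
the state `τ`. -/
structure SearchResult (succ : V → List V) (s : V) (k : ℕ) (σ : SearchState V) (v : V) (b : ℕ∞)
    (τ : SearchState V) : Prop where
  isProgress : IsProgress σ τ
  isValid : τ.IsValid succ s k
  lock_le : b = ⊤ → τ.lock ≤ σ.lock ∧ τ.lock v ≤ σ.stack.length
  mem_output : ∀ p, IsShortCycle succ s k p → σ.stack ++ [v] <+: p → p ++ [s] ∈ τ.output

/-- The loop invariant of `CYCLE_SEARCH` at `v`, called in the state `σ`: the successors in `l` have
been examined, the current value of `blen` is `b`, and the current state is `τ`. -/
structure LoopInvariant (succ : V → List V) (s : V) (k : ℕ) (σ : SearchState V) (v : V)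
    (l : List V) (b : ℕ∞) (τ : SearchState V) : Prop where
  isProgress : IsProgress (σ.push v) τ
  isValid : τ.IsValid succ s k
  lock_le : b = ⊤ → τ.lock ≤ σ.lock ∧ τ.DeadEnd s k σ.stack.length l
  mem_output : ∀ w ∈ l, ∀ p, IsShortCycle succ s k p → σ.stack ++ [v] ++ [w] <+: p ++ [s] →
    p ++ [s] ∈ τ.output

namespace LoopInvariant

theorem push (hσ : σ.IsValid succ s k) (hv : (σ.stack.length : ℕ∞) < σ.lock v) :
    LoopInvariant succ s k σ v [] ⊤ (σ.push v) where
  isProgress := .refl _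
  isValid := hσ.push hv
  lock_le _ := ⟨lock_push_le hv, by simp [DeadEnd]⟩
  mem_output := by simp

theorem stack_eq (h : LoopInvariant succ s k σ v l b τ) : τ.stack = σ.stack ++ [v] :=
  h.isProgress.stack_eq

theorem lock_self (h : LoopInvariant succ s k σ v l b τ) : τ.lock v = σ.stack.length :=
  (h.isProgress.lock_eq v (by simp [SearchState.push])).trans (Function.update_self ..)

theorem lock_eq (h : LoopInvariant succ s k σ v l b τ) (hv : v ∉ σ.stack) {x : V}
    (hx : x ∈ σ.stack) : τ.lock x = σ.lock x :=
  (h.isProgress.lock_eq x (by simp [SearchState.push, hx])).trans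
    (Function.update_of_ne (ne_of_mem_of_not_mem hx hv) ..)

theorem concat_start (h : LoopInvariant succ s k σ v l b τ) :
    LoopInvariant succ s k σ v (l ++ [s]) 1
      { τ with output := τ.output ++ [τ.stack ++ [s]] } where
  isProgress := h.isProgress.trans ⟨rfl, List.subset_append_left .., fun _ _ => rfl⟩
  isValid := ⟨h.isValid.lock_le, h.isValid.finite_locked, h.isValid.locksConsistent⟩
  lock_le h1 := absurd h1 ENat.one_ne_top
  mem_output w hw p hp hwp := by
    rcases List.mem_append.1 hw with hw | hw
    · exact List.mem_append_left _ (h.mem_output w hw p hp hwp)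
    · rw [List.mem_singleton.1 hw] at hwp
      simp [hp.eq_of_isPrefix (by simp) hwp, h.stack_eq]

theorem concat_searchResult (h : LoopInvariant succ s k σ v l b τ) (hws : w ≠ s)
    (hw : SearchResult succ s k τ w b' ρ) :
    LoopInvariant succ s k σ v (l ++ [w]) (min b (1 + b')) ρ where
  isProgress := h.isProgress.trans hw.isProgress
  isValid := hw.isValid
  lock_le hb := by
    obtain ⟨hb, hb'⟩ : b = ⊤ ∧ b' = ⊤ := by simpa using hb
    obtain ⟨hτσ, hdead⟩ := h.lock_le hb
    obtain ⟨hρτ, hρw⟩ := hw.lock_le hb'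
    exact ⟨hρτ.trans hτσ, hdead.concat hρτ hws fun _ => by simpa [h.stack_eq] using hρw⟩
  mem_output x hx p hp hxp := by
    rcases List.mem_append.1 hx with hx | hx
    · exact hw.isProgress.output_subset (h.mem_output x hx p hp hxp)
    · rw [List.mem_singleton.1 hx] at hxp
      refine hw.mem_output p hp ?_
      rw [h.stack_eq]
      exact isPrefix_of_isPrefix_concat_of_ne hws hxp

theorem concat_skip (h : LoopInvariant succ s k σ v l b τ) (hws : w ≠ s)
    (hw : ¬(((σ.stack.length + 1 : ℕ) : ℕ∞) < τ.lock w ∧ σ.stack.length + 1 < k)) :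
    LoopInvariant succ s k σ v (l ++ [w]) b τ where
  isProgress := h.isProgress
  isValid := h.isValid
  lock_le hb := by
    obtain ⟨hτσ, hdead⟩ := h.lock_le hb
    exact ⟨hτσ, hdead.concat le_rfl hws fun hk => not_lt.1 fun hlt => hw ⟨hlt, hk⟩⟩
  mem_output x hx p hp hxp := by
    rcases List.mem_append.1 hx with hx | hx
    · exact h.mem_output x hx p hp hxp
    · rw [List.mem_singleton.1 hx] at hxp
      have hwp : τ.stack ++ [w] <+: p := by
        rw [h.stack_eq]
        exact isPrefix_of_isPrefix_concat_of_ne hws hxp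
      have hlock := h.isValid.locksConsistent.lt_lock_of_isPrefix hp hwp
      rw [h.stack_eq, List.length_append, List.length_singleton] at hlock
      exact absurd hlock.symm hw

theorem searchResult_pop (h : LoopInvariant succ s k σ v (succ v) b τ) (hσ : σ.IsValid succ s k)
    (hv : v ∉ σ.stack) (hstack : ρ.stack = τ.stack) (houtput : ρ.output = τ.output)
    (hlock : ∀ x, ρ.lock x = τ.lock x ∨ x ∉ σ.stack ∧ ρ.lock x = ⊤)
    (hb : b = ⊤ → ρ.lock = τ.lock) (hρ : ρ.pop.LocksConsistent succ s k) :
    SearchResult succ s k σ v b ρ.pop := by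
  have hpop : ρ.pop.stack = σ.stack := by simp [pop, hstack, h.stack_eq]
  have hlock_eq : ∀ x ∈ σ.stack, ρ.lock x = σ.lock x := fun x hx =>
    ((hlock x).resolve_right fun h => h.1 hx).trans (h.lock_eq hv hx)
  refine ⟨⟨hpop, ?_, hlock_eq⟩, ⟨?_, ?_, hρ⟩, fun hbt => ?_, fun p hp hvp => ?_⟩
  · exact houtput ▸ h.isProgress.output_subset
  · intro x hx
    rw [hpop] at hx ⊢
    exact (hlock_eq x hx).trans_le (hσ.lock_le x hx)
  · refine h.isValid.finite_locked.subset fun x (hx : ρ.lock x ≠ ⊤) => ?_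
    exact ((hlock x).resolve_right fun htop => hx htop.2).symm.trans_ne hx
  · exact ⟨(hb hbt).trans_le (h.lock_le hbt).1, (congrFun (hb hbt) v).trans_le h.lock_self.le⟩
  · obtain ⟨w, hw, hwp⟩ := hp.exists_mem_succ_isPrefix hvp
    exact houtput ▸ h.mem_output w hw p hp hwp

theorem searchResult_of_relaxResult (h : LoopInvariant succ s k σ v (succ v) b τ)
    (hσ : σ.IsValid succ s k) (hv : v ∉ σ.stack) (hb : b ≠ ⊤) (hρ : RelaxResult v τ ρ) :
    SearchResult succ s k σ v b ρ.pop := by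
  refine h.searchResult_pop hσ hv hρ.stack_eq hρ.output_eq (fun x => ?_) (absurd · hb)
    (h.isValid.locksConsistent.pop_of_relaxResult hρ h.stack_eq)
  refine (hρ.lock_eq_or_of_unlock x).imp_right (And.imp_left ?_)
  rintro (rfl | hx)
  · exact hv
  · exact fun hxσ => hx (by simp [h.stack_eq, hxσ])

theorem searchResult_foldl_addToBlist (h : LoopInvariant succ s k σ v (succ v) b τ)
    (hσ : σ.IsValid succ s k) (hv : v ∉ σ.stack) (hb : b = ⊤) :
    SearchResult succ s k σ v b ((succ v).foldl (addToBlist v) τ).pop := by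
  have hlock : ((succ v).foldl (addToBlist v) τ).lock = τ.lock := by rw [foldl_addToBlist]
  exact h.searchResult_pop hσ hv (by rw [foldl_addToBlist]) (by rw [foldl_addToBlist])
    (fun x => .inl (congrFun hlock x)) (fun _ => hlock)
    (h.isValid.locksConsistent.pop_foldl_addToBlist h.stack_eq h.lock_self (h.lock_le hb).2)

end LoopInvariant

/-- The examination of the successor `w` in the loop of `CYCLE_SEARCH` at depth `flen`, with `n` as
the recursion bound of the nested call. -/
noncomputable def searchStep (succ : V → List V) (order : SearchState V → V → List V) (s : V)
    (k flen n : ℕ) (x : ℕ∞ × SearchState V) (w : V) : Option (ℕ∞ × SearchState V) :=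
  if w = s then
    some (1, { x.2 with output := x.2.output ++ [x.2.stack ++ [w]] })
  else if ((flen + 1 : ℕ) : ℕ∞) < x.2.lock w ∧ flen + 1 < k then do
    let y ← cycleSearch succ order s k n w (flen + 1) x.2
    some (min x.1 (1 + y.1), y.2)
  else some x

theorem cycleSearch_length_stack (order : SearchState V → V → List V) (n : ℕ) :
    cycleSearch succ order s k (n + 1) v σ.stack.length σ =
      ((succ v).foldlM (searchStep succ order s k σ.stack.length n) (⊤, σ.push v)).bind fun r =>
      (if r.1 < ⊤ then relaxLocks order n v r.2
        else some ((succ v).foldl (addToBlist v) r.2)).bind fun τ =>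
      some (r.1, τ.pop) := by
  rw [cycleSearch]
  congr 1
  funext r
  split_ifs <;> rfl

theorem LoopInvariant.exists_searchStep_eq {order : SearchState V → V → List V}
    (h : LoopInvariant succ s k σ v l b τ) (w : V)
    (hsearch : τ.stack.length < k → (τ.stack.length : ℕ∞) < τ.lock w →
      ∃ b' ρ, SearchResult succ s k τ w b' ρ ∧
        ∀ᶠ n in atTop, cycleSearch succ order s k n w τ.stack.length τ = some (b', ρ)) :
    ∃ y, LoopInvariant succ s k σ v (l ++ [w]) y.1 y.2 ∧
      ∀ᶠ n in atTop, searchStep succ order s k σ.stack.length n (b, τ) w = some y := by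
  have hlen : τ.stack.length = σ.stack.length + 1 := by simp [h.stack_eq]
  rw [hlen] at hsearch
  unfold searchStep
  split_ifs with hws hw
  · exact ⟨_, hws ▸ h.concat_start, .of_forall fun _ => rfl⟩
  · obtain ⟨b', ρ, hρ, hrun⟩ := hsearch hw.2 hw.1
    refine ⟨(min b (1 + b'), ρ), h.concat_searchResult hws hρ, ?_⟩
    filter_upwards [hrun] with n hn
    simp [hn]
  · exact ⟨_, h.concat_skip hws hw, .of_forall fun _ => rfl⟩

theorem LoopInvariant.exists_finish_eq {order : SearchState V → V → List V}
    (horder : ∀ σ u, ∀ w ∈ σ.blist u, w ∈ order σ u)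
    (h : LoopInvariant succ s k σ v (succ v) b τ) (hσ : σ.IsValid succ s k) (hv : v ∉ σ.stack) :
    ∃ ρ, SearchResult succ s k σ v b ρ.pop ∧
      ∀ᶠ n in atTop, (if b < ⊤ then relaxLocks order n v τ
        else some ((succ v).foldl (addToBlist v) τ)) = some ρ := by
  split_ifs with hb
  · obtain ⟨ρ, hρ, hrun⟩ := exists_relaxLocks_eq horder v τ h.isValid.finite_locked
    exact ⟨ρ, h.searchResult_of_relaxResult hσ hv hb.ne hρ, hrun⟩
  · exact ⟨_, h.searchResult_foldl_addToBlist hσ hv (not_lt_top_iff.1 hb),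
      .of_forall fun _ => rfl⟩

theorem exists_cycleSearch_eq {order : SearchState V → V → List V}
    (horder : ∀ σ u, ∀ w ∈ σ.blist u, w ∈ order σ u) (v : V) (σ : SearchState V)
    (hσ : σ.IsValid succ s k) (hv : (σ.stack.length : ℕ∞) < σ.lock v) :
    ∃ b τ, SearchResult succ s k σ v b τ ∧
      ∀ᶠ n in atTop, cycleSearch succ order s k n v σ.stack.length σ = some (b, τ) := by
  induction hd : k - σ.stack.length using Nat.strong_induction_on generalizing v σ with
  | h d ih =>
  subst hd
  obtain ⟨⟨b, τ⟩, hτ, hloop⟩ := exists_eventually_foldlM_eq_pure (succ v) (F := atTop)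
    (f := searchStep succ order s k σ.stack.length) (x := (⊤, σ.push v))
    (P := fun l y => LoopInvariant succ s k σ v l y.1 y.2) (.push hσ hv) fun l w y hy =>
      hy.exists_searchStep_eq w fun hk hw =>
        ih _ (by rw [hy.stack_eq, List.length_append, List.length_singleton] at hk ⊢; lia)
          w y.2 hy.isValid hw rfl
  obtain ⟨ρ, hρ, hfinish⟩ := hτ.exists_finish_eq horder hσ (hσ.notMem_stack hv)
  refine ⟨b, ρ.pop, hρ, ?_⟩
  rw [← map_add_atTop_eq_nat 1, eventually_map]
  filter_upwards [hloop, hfinish] with n hn hn'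
  simp [cycleSearch_length_stack, hn, hn']

end Search

end SearchState

theorem lemma2_general {V : Type*} [DecidableEq V] (Gs : Digraph V)
    (succ : V → List V) (hsucc : ∀ v w, w ∈ succ v ↔ Gs.Adj v w)
    (order : SearchState V → V → List V)
    (horder : ∀ σ u w, w ∈ order σ u ↔ w ∈ σ.blist u)
    (s : V) (k : ℕ) :
    ∃ (blen : ℕ∞) (σ : SearchState V),
      (∃ N : ℕ, ∀ n ≥ N,
        cycleSearch succ order s k n s 0 (SearchState.init V) = some (blen, σ)) ∧
      ∀ c : List V, IsSimpleCycle Gs c → c.head? = some s → pathLength c ≤ k →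
        c ∈ σ.output := by
  obtain ⟨blen, σ, hσ, hrun⟩ := SearchState.exists_cycleSearch_eq
    (fun σ u w => (horder σ u w).2) s (.init V) (SearchState.isValid_init succ s k)
    (by simp [SearchState.init])
  refine ⟨blen, σ, eventually_atTop.1 hrun, fun c hc hs hk => ?_⟩
  obtain ⟨p, hp, rfl⟩ := hc.exists_isShortCycle (fun v w => (hsucc v w).2) hs hk
  obtain ⟨q, rfl⟩ := List.head?_eq_some_iff.1 hp.head?_eq
  exact hσ.mem_output _ hp (by simp [SearchState.init])

theorem lemma2 {V : Type*} [Fintype V] [DecidableEq V] (Gs : Digraph V)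
    (succ : V → List V) (hsucc : ∀ v w, w ∈ succ v ↔ Gs.Adj v w)
    (order : SearchState V → V → List V)
    (horder : ∀ σ u w, w ∈ order σ u ↔ w ∈ σ.blist u)
    (s : V) (k : ℕ) :
    ∃ (blen : ℕ∞) (σ : SearchState V),
      (∃ N : ℕ, ∀ n ≥ N,
        cycleSearch succ order s k n s 0 (SearchState.init V) = some (blen, σ)) ∧
      ∀ c : List V, IsSimpleCycle Gs c → c.head? = some s → pathLength c ≤ k →
        c ∈ σ.output := by
  exact lemma2_general Gs succ hsucc order horder s k
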